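/- Let $n\ge 2$ be an odd integer and let $G=SD_{8n}=\langle a,b\mid a^{4n}=b^2=1,\ bab=a^{2n-1}\rangle$ be the semidihedral group of order $8n$, regarded as a subgroup of the symmetric group $S_{4n}$ on the residues modulo $4n$ through $a\mapsto (t\mapsto t+1)$ and $b\mapsto (t\mapsto (2n-1)t)$. Let $h'\in C^{\dagger}_{even}=\{2,4,\dots,2n-2\}$ and let $\varsigma=\varsigma_{h'}$ be the character of the two-dimensional representation $\rho^{h'}$ of $G$ given, with $\omega=e^{i\pi/(2n)}$, by $$\rho^{h'}(a^r)=\begin{pmatrix}\omega^{h'r}&0\\0&\omega^{(2n-1)h'r}\end{pmatrix},\qquad \rho^{h'}(ba^r)=\begin{pmatrix}0&\omega^{(2n-1)h'r}\\ \omega^{h'r}&0\end{pmatrix},$$ so that $\varsigma(a^r)=2\cos\frac{h'r\pi}{2n}$ and $\varsigma(ba^r)=0$. Let $V$ be a finite-dimensional complex inner product space with $d=\dim V\ge 2$ and let $\{e_1,\dots,e_d\}$ be an orthonormal basis of $V$. Put $P_\sigma(v_1\otimes\cdots\otimes v_{4n})=v_{\sigma^{-1}(1)}\otimes\cdots\otimes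 v_{\sigma^{-1}(4n)}$, let $T(G,\varsigma)=\frac{\varsigma(1)}{|G|}\sum_{\sigma\in G}\varsigma(\sigma)P_\sigma$ on $V^{\otimes 4n}$, let $V_\varsigma(G)$ be the image of $T(G,\varsigma)$, with the inner product induced from $V^{\otimes 4n}$, on which $\langle v_1\otimes\cdots\otimes v_{4n},u_1\otimes\cdots\otimes u_{4n}\rangle=\prod_i\langle v_i,u_i\rangle$, and for $\alpha\in\{1,\dots,d\}^{4n}$ let $e^*_\alpha=T(G,\varsigma)(e_{\alpha_1}\otimes\cdots\otimes e_{\alpha_{4n}})$. Then $V_\varsigma(G)$ has no orthogonal $*$-basis, that is, no basis of $V_\varsigma(G)$ consists of pairwise orthogonal vectors of the form $e^*_\alpha$. -/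

import Mathlib

open scoped TensorProduct

/-- The semidihedral group `SD_{8n} = ⟨a, b ∣ a^{4n} = b² = 1, bab = a^{2n-1}⟩`, given by its `8n`
normal forms: `a r` stands for `a^r` and `ba r` stands for `b a^r`, with `r` modulo `4n`. -/
inductive SemidihedralGroup (n : ℕ) : Type
  | a : ZMod (4 * n) → SemidihedralGroup n
  | ba : ZMod (4 * n) → SemidihedralGroup n

namespace SemidihedralGroup

/-- Multiplication of normal forms, forced by `a^r b = b a^{(2n-1)r}` and `b² = 1`. -/
protected def mul {n : ℕ} : SemidihedralGroup n → SemidihedralGroup n → SemidihedralGroup n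
  | a r, a s => a (r + s)
  | a r, ba s => ba ((2 * (n : ZMod (4 * n)) - 1) * r + s)
  | ba r, a s => ba (r + s)
  | ba r, ba s => a ((2 * (n : ZMod (4 * n)) - 1) * r + s)

/-- Inversion of normal forms: `(a^r)⁻¹ = a^{-r}` and `(b a^r)⁻¹ = b a^{(2n+1)r}`. -/
protected def inv {n : ℕ} : SemidihedralGroup n → SemidihedralGroup n
  | a r => a (-r)
  | ba r => ba ((2 * (n : ZMod (4 * n)) + 1) * r)

theorem four_mul_cast_eq_zero (n : ℕ) : (4 * n : ZMod (4 * n)) = 0 := by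
  have h := ZMod.natCast_self (4 * n)
  push_cast at h
  exact h

theorem twist_sq (n : ℕ) : ((2 * n - 1) * (2 * n - 1) : ZMod (4 * n)) = 1 := by
  linear_combination (n - 1 : ZMod (4 * n)) * four_mul_cast_eq_zero n

instance (n : ℕ) : Group (SemidihedralGroup n) where
  mul := SemidihedralGroup.mul
  one := a 0
  inv := SemidihedralGroup.inv
  mul_assoc := by
    have h := twist_sq n
    rintro (r | r) (s | s) (t | t)
    · exact congrArg a (by ring)
    · exact congrArg ba (by ring)
    · exact congrArg ba (by ring)
    · exact congrArg a (by linear_combination (r : ZMod (4 * n)) * h)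
    · exact congrArg ba (by ring)
    · exact congrArg a (by ring)
    · exact congrArg a (by ring)
    · exact congrArg ba (by linear_combination (r : ZMod (4 * n)) * h)
  one_mul := by
    rintro (r | r)
    · exact congrArg a (by ring)
    · exact congrArg ba (by ring)
  mul_one := by
    rintro (r | r)
    · exact congrArg a (by ring)
    · exact congrArg ba (by ring)
  inv_mul_cancel := by
    rintro (r | r)
    · exact congrArg a (by ring)
    · exact congrArg a
        (by linear_combination (n * r : ZMod (4 * n)) * four_mul_cast_eq_zero n)

/-- The normal forms are two copies of `ℤ/4n`. -/
def equivSum (n : ℕ) : SemidihedralGroup n ≃ ZMod (4 * n) ⊕ ZMod (4 * n) where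
  toFun
    | a r => Sum.inl r
    | ba r => Sum.inr r
  invFun
    | Sum.inl r => a r
    | Sum.inr r => ba r
  left_inv := by rintro (r | r) <;> rfl
  right_inv := by rintro (r | r) <;> rfl

instance (n : ℕ) [NeZero n] : Fintype (SemidihedralGroup n) :=
  Fintype.ofEquiv _ (equivSum n).symm

theorem card_eq (n : ℕ) [NeZero n] : Fintype.card (SemidihedralGroup n) = 8 * n := by
  rw [Fintype.card_congr (equivSum n), Fintype.card_sum, ZMod.card]
  ring

theorem a_mul_a {n : ℕ} (r s : ZMod (4 * n)) : a r * a s = a (r + s) := rfl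

theorem a_mul_ba {n : ℕ} (r s : ZMod (4 * n)) :
    a r * ba s = ba ((2 * (n : ZMod (4 * n)) - 1) * r + s) := rfl

theorem ba_mul_a {n : ℕ} (r s : ZMod (4 * n)) : ba r * a s = ba (r + s) := rfl

theorem ba_mul_ba {n : ℕ} (r s : ZMod (4 * n)) :
    ba r * ba s = a ((2 * (n : ZMod (4 * n)) - 1) * r + s) := rfl

theorem one_def {n : ℕ} : (1 : SemidihedralGroup n) = a 0 := rfl

theorem a_one_pow {n : ℕ} (k : ℕ) : (a 1 : SemidihedralGroup n) ^ k = a k := by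
  induction k with
  | zero => simp [one_def]
  | succ k ih => rw [pow_succ, ih, a_mul_a]; push_cast; rfl

/-- Every element is some `a^k` or `b a^k`, where `a = a 1` and `b = ba 0`. -/
theorem eq_pow_or_eq_mul_pow {n : ℕ} [NeZero n] (g : SemidihedralGroup n) :
    ∃ k < 4 * n, g = a 1 ^ k ∨ g = ba 0 * a 1 ^ k := by
  rcases g with (r | r)
  · exact ⟨r.val, ZMod.val_lt r, Or.inl (by rw [a_one_pow, ZMod.natCast_zmod_val])⟩
  · exact ⟨r.val, ZMod.val_lt r,
      Or.inr (by rw [a_one_pow, ZMod.natCast_zmod_val, ba_mul_a, zero_add])⟩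

/-- The defining relations hold for `a = a 1` and `b = ba 0`. -/
theorem relations (n : ℕ) [NeZero n] :
    (a 1 : SemidihedralGroup n) ^ (4 * n) = 1 ∧ (ba 0 : SemidihedralGroup n) ^ 2 = 1 ∧
      (ba 0 * a 1 * ba 0 : SemidihedralGroup n) = a 1 ^ (2 * n - 1) := by
  refine ⟨?_, ?_, ?_⟩
  · rw [a_one_pow, ZMod.natCast_self, one_def]
  · rw [pow_two, ba_mul_ba, one_def]
    simp
  · have h : 1 ≤ 2 * n := by have := NeZero.pos n; omega
    rw [ba_mul_a, ba_mul_ba, a_one_pow]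
    push_cast [h]
    simp

/-- Multiplication by `2n - 1` on `ℤ/4n`, the permutation assigned to `b`. -/
def twist (n : ℕ) : Equiv.Perm (ZMod (4 * n)) where
  toFun t := (2 * (n : ZMod (4 * n)) - 1) * t
  invFun t := (2 * (n : ZMod (4 * n)) - 1) * t
  left_inv t := by linear_combination (t : ZMod (4 * n)) * twist_sq n
  right_inv t := by linear_combination (t : ZMod (4 * n)) * twist_sq n

/-- The homomorphism `SD_{8n} → S_{4n}` with `a ↦ (t ↦ t + 1)` and `b ↦ (t ↦ (2n-1) t)`, where the
`4n` points are the residues modulo `4n`. -/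
def toPerm (n : ℕ) : SemidihedralGroup n →* Equiv.Perm (ZMod (4 * n)) where
  toFun
    | a r => Equiv.addRight r
    | ba r => twist n * Equiv.addRight r
  map_one' := by
    change Equiv.addRight (0 : ZMod (4 * n)) = 1
    ext t
    simp
  map_mul' := by
    have h := twist_sq n
    rintro (r | r) (s | s)
    · exact Equiv.ext fun t => show t + (r + s) = t + s + r by ring
    · exact Equiv.ext fun t => show (2 * n - 1) * (t + ((2 * n - 1) * r + s)) =
        (2 * n - 1) * (t + s) + r by linear_combination (r : ZMod (4 * n)) * h
    · exact Equiv.ext fun t => show (2 * n - 1) * (t + (r + s)) = (2 * n - 1) * (t + s + r) by ring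
    · exact Equiv.ext fun t => show t + ((2 * n - 1) * r + s) =
        (2 * n - 1) * ((2 * n - 1) * (t + s) + r) by
          linear_combination (-(t + s) : ZMod (4 * n)) * h

/-- For `n ≥ 2` the homomorphism is an embedding, so `SD_{8n}` is a subgroup of `S_{4n}`. -/
theorem toPerm_injective {n : ℕ} (hn : 2 ≤ n) : Function.Injective (toPerm n) := by
  have key : ∀ r s : ZMod (4 * n), toPerm n (a r) ≠ toPerm n (ba s) := by
    intro r s h
    have h0 : (0 : ZMod (4 * n)) + r = (2 * n - 1) * (0 + s) := congrArg (fun e => e 0) h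
    have h1 : (1 : ZMod (4 * n)) + r = (2 * n - 1) * (1 + s) := congrArg (fun e => e 1) h
    have h2 : ((2 * n - 2 : ℕ) : ZMod (4 * n)) = 0 := by
      have : 2 ≤ 2 * n := by omega
      push_cast [this]
      linear_combination h0 - h1
    rw [ZMod.natCast_eq_zero_iff] at h2
    have := Nat.le_of_dvd (by omega) h2
    omega
  rintro (r | r) (s | s) h
  · have h0 : (0 : ZMod (4 * n)) + r = 0 + s := congrArg (fun e => e 0) h
    simpa using h0
  · exact absurd h (key r s)
  · exact absurd h.symm (key s r)
  · have h' : twist n * Equiv.addRight r = twist n * Equiv.addRight s := h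
    have h0 : (0 : ZMod (4 * n)) + r = 0 + s := congrArg (fun e => e 0) (mul_left_cancel h')
    simpa using h0

/-- `ω = e^{iπ/(2n)}`, a primitive `4n`-th root of unity. -/
noncomputable def omega (n : ℕ) : ℂ := Complex.exp (Complex.I * Real.pi / (2 * n))

theorem omega_pow_congr {n : ℕ} [NeZero n] {k l : ℕ} (h : (k : ZMod (4 * n)) = l) :
    omega n ^ k = omega n ^ l := by
  have hω : omega n ^ (4 * n) = 1 := by
    have hn : (n : ℂ) ≠ 0 := Nat.cast_ne_zero.2 (NeZero.ne n)
    rw [omega, ← Complex.exp_nat_mul, ← Complex.exp_two_pi_mul_I]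
    congr 1
    push_cast
    field_simp
    ring
  rw [ZMod.natCast_eq_natCast_iff] at h
  rw [← Nat.mod_add_div k (4 * n), ← Nat.mod_add_div l (4 * n), pow_add, pow_add,
    pow_mul _ (4 * n), pow_mul _ (4 * n), hω, one_pow, one_pow, h]

theorem cast_two_mul_sub_one (n : ℕ) [NeZero n] :
    ((2 * n - 1 : ℕ) : ZMod (4 * n)) = 2 * n - 1 := by
  have h : 1 ≤ 2 * n := by have := NeZero.pos n; omega
  push_cast [h]
  rfl

/-- The two-dimensional representation `ρ^h` of `SD_{8n}`, in matrix form. -/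
noncomputable def rho (n h : ℕ) [NeZero n] :
    SemidihedralGroup n →* Matrix (Fin 2) (Fin 2) ℂ where
  toFun
    | a r => !![omega n ^ (h * r.val), 0; 0, omega n ^ ((2 * n - 1) * h * r.val)]
    | ba r => !![0, omega n ^ ((2 * n - 1) * h * r.val); omega n ^ (h * r.val), 0]
  map_one' := by
    change !![omega n ^ (h * (0 : ZMod (4 * n)).val), 0;
      0, omega n ^ ((2 * n - 1) * h * (0 : ZMod (4 * n)).val)] = 1
    simp [Matrix.one_fin_two]
  map_mul' := by
    have hc := cast_two_mul_sub_one n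
    have hs := twist_sq n
    rintro (r | r) (s | s)
    all_goals
      simp only [a_mul_a, a_mul_ba, ba_mul_a, ba_mul_ba, Matrix.mul_fin_two, ← pow_add, mul_zero,
        zero_mul, add_zero, zero_add]
    · rw [omega_pow_congr (k := h * (r + s).val) (l := h * r.val + h * s.val),
        omega_pow_congr (k := (2 * n - 1) * h * (r + s).val)
          (l := (2 * n - 1) * h * r.val + (2 * n - 1) * h * s.val)]
      all_goals
        simp only [Nat.cast_add, Nat.cast_mul, hc, ZMod.natCast_val, ZMod.cast_id', id]
        ring
    · rw [omega_pow_congr (k := h * ((2 * n - 1) * r + s).val)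
          (l := (2 * n - 1) * h * r.val + h * s.val),
        omega_pow_congr (k := (2 * n - 1) * h * ((2 * n - 1) * r + s).val)
          (l := h * r.val + (2 * n - 1) * h * s.val)]
      · simp only [Nat.cast_add, Nat.cast_mul, hc, ZMod.natCast_val, ZMod.cast_id', id]
        linear_combination (h * r : ZMod (4 * n)) * hs
      · simp only [Nat.cast_add, Nat.cast_mul, hc, ZMod.natCast_val, ZMod.cast_id', id]
        ring
    · rw [omega_pow_congr (k := h * (r + s).val) (l := h * r.val + h * s.val),
        omega_pow_congr (k := (2 * n - 1) * h * (r + s).val)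
          (l := (2 * n - 1) * h * r.val + (2 * n - 1) * h * s.val)]
      all_goals
        simp only [Nat.cast_add, Nat.cast_mul, hc, ZMod.natCast_val, ZMod.cast_id', id]
        ring
    · rw [omega_pow_congr (k := h * ((2 * n - 1) * r + s).val)
          (l := (2 * n - 1) * h * r.val + h * s.val),
        omega_pow_congr (k := (2 * n - 1) * h * ((2 * n - 1) * r + s).val)
          (l := h * r.val + (2 * n - 1) * h * s.val)]
      · simp only [Nat.cast_add, Nat.cast_mul, hc, ZMod.natCast_val, ZMod.cast_id', id]
        linear_combination (h * r : ZMod (4 * n)) * hs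
      · simp only [Nat.cast_add, Nat.cast_mul, hc, ZMod.natCast_val, ZMod.cast_id', id]
        ring

/-- The character `ς_h` of `ρ^h`. -/
noncomputable def sigmaChar (n h : ℕ) [NeZero n] (g : SemidihedralGroup n) : ℂ :=
  (rho n h g).trace

/-- The values of `ς_h` on the powers of `a`, for even `h`. -/
theorem sigmaChar_a {n h : ℕ} [NeZero n] (hh : Even h) (r : ZMod (4 * n)) :
    sigmaChar n h (a r) = 2 * Complex.cos (h * r.val * Real.pi / (2 * n)) := by
  have hn : (n : ℂ) ≠ 0 := Nat.cast_ne_zero.2 (NeZero.ne n)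
  have e : ∀ k : ℕ, omega n ^ k = Complex.exp (k * Real.pi / (2 * n) * Complex.I) := by
    intro k
    rw [omega, ← Complex.exp_nat_mul]
    congr 1
    ring
  have hinv : omega n ^ ((2 * n - 1) * h * r.val) * omega n ^ (h * r.val) = 1 := by
    rw [← pow_add, ← pow_zero (omega n)]
    apply omega_pow_congr
    obtain ⟨m, rfl⟩ := hh
    simp only [Nat.cast_add, Nat.cast_mul, cast_two_mul_sub_one, Nat.cast_zero]
    linear_combination (m * r.val : ZMod (4 * n)) * four_mul_cast_eq_zero n
  have h2 : omega n ^ ((2 * n - 1) * h * r.val) =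
      Complex.exp (-((h * r.val : ℕ) * Real.pi / (2 * n)) * Complex.I) := by
    rw [eq_inv_of_mul_eq_one_left hinv, e, ← Complex.exp_neg, neg_mul]
  change Matrix.trace !![omega n ^ (h * r.val), 0; 0, omega n ^ ((2 * n - 1) * h * r.val)] = _
  rw [Matrix.trace_fin_two_of, e, h2, Complex.two_cos]
  push_cast
  rfl

theorem sigmaChar_ba {n h : ℕ} [NeZero n] (r : ZMod (4 * n)) : sigmaChar n h (ba r) = 0 := by
  change Matrix.trace !![0, omega n ^ ((2 * n - 1) * h * r.val); omega n ^ (h * r.val), 0] = _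
  rw [Matrix.trace_fin_two_of, add_zero]

/-- `C₁ = {0, 2, 4, …, 2n}`. -/
def C1 (n : ℕ) : Set ℕ := {k | Even k ∧ k ≤ 2 * n}

/-- `C†_even = C₁ \ {0, 2n}`. -/
def CdagEven (n : ℕ) : Set ℕ := C1 n \ {0, 2 * n}

end SemidihedralGroup

namespace SymmetryClass

section

variable {ι : Type*} [Fintype ι] {V : Type*} [NormedAddCommGroup V] [InnerProductSpace ℂ V]

/-- `u ↦ ⟨v₁ ⊗ ⋯ ⊗ v_m, u⟩` as a linear functional on the tensor power of `V` indexed by `ι`. -/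
noncomputable def innerTprod (v : ι → V) : (⨂[ℂ] _ : ι, V) →ₗ[ℂ] ℂ :=
  PiTensorProduct.lift
    ((MultilinearMap.mkPiAlgebra ℂ ι ℂ).compLinearMap fun i => (innerSL ℂ (v i)).toLinearMap)

theorem innerTprod_tprod (v u : ι → V) :
    innerTprod v (PiTensorProduct.tprod ℂ u) = ∏ i, inner ℂ (v i) (u i) := by
  simp [innerTprod]

/-- The conjugate `y ↦ ⟨y, u₁ ⊗ ⋯ ⊗ u_m⟩` of `innerTprod u`, as a multilinear map in `u`. -/
noncomputable def innerTprodConj :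
    MultilinearMap ℂ (fun _ : ι => V) ((⨂[ℂ] _ : ι, V) →ₗ⋆[ℂ] ℂ) where
  toFun u := (starLinearEquiv ℂ (A := ℂ)).toLinearMap.comp (innerTprod u)
  map_update_add' u i x y := by
    have key : innerTprod (Function.update u i (x + y)) =
        innerTprod (Function.update u i x) + innerTprod (Function.update u i y) := by
      ext v
      simp only [LinearMap.compMultilinearMap_apply, LinearMap.add_apply, innerTprod_tprod,
        ← Finset.mul_prod_erase Finset.univ _ (Finset.mem_univ i), Function.update_self,
        inner_add_left, add_mul]
      congr 2 <;> refine Finset.prod_congr rfl fun j hj => ?_ <;>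
        simp [Function.update_of_ne (Finset.ne_of_mem_erase hj)]
    ext z
    simp [key]
  map_update_smul' u i c x := by
    have key : innerTprod (Function.update u i (c • x)) =
        star c • innerTprod (Function.update u i x) := by
      ext v
      simp only [LinearMap.compMultilinearMap_apply, LinearMap.smul_apply, innerTprod_tprod,
        ← Finset.mul_prod_erase Finset.univ _ (Finset.mem_univ i), Function.update_self,
        inner_smul_left, smul_eq_mul, mul_assoc, starRingEnd_apply]
      congr 2
      refine Finset.prod_congr rfl fun j hj => ?_
      simp [Function.update_of_ne (Finset.ne_of_mem_erase hj)]
    ext z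
    simp [key]

/-- The inner product on the tensor power of `V` induced by the one on `V`: the form, linear in
the second and conjugate-linear in the first argument, with
`⟨v₁ ⊗ ⋯ ⊗ v_m, u₁ ⊗ ⋯ ⊗ u_m⟩ = ∏ i, ⟨vᵢ, uᵢ⟩`. -/
noncomputable def tensorInner (x y : ⨂[ℂ] _ : ι, V) : ℂ :=
  PiTensorProduct.lift innerTprodConj y x

theorem tensorInner_tprod (v u : ι → V) :
    tensorInner (PiTensorProduct.tprod ℂ v) (PiTensorProduct.tprod ℂ u) =
      ∏ i, inner ℂ (v i) (u i) := by
  simp [tensorInner, innerTprodConj, innerTprod_tprod]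

variable {G : Type*} [Group G] [Fintype G]

/-- The symmetrizer `T(G, χ) = χ(1)/|G| ∑_{g ∈ G} χ(g) P_g` of a finite group `G` acting on the
index set `ι` through `T`, where `P_σ (v₁ ⊗ ⋯ ⊗ v_m) = v_{σ⁻¹(1)} ⊗ ⋯ ⊗ v_{σ⁻¹(m)}`. -/
noncomputable def symmetrizer (T : G →* Equiv.Perm ι) (χ : G → ℂ) (V : Type*)
    [NormedAddCommGroup V] [InnerProductSpace ℂ V] :
    (⨂[ℂ] _ : ι, V) →ₗ[ℂ] (⨂[ℂ] _ : ι, V) :=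
  (χ 1 / Fintype.card G) •
    ∑ g, χ g • (PiTensorProduct.reindex ℂ (fun _ : ι => V) (T g)).toLinearMap

/-- The symmetry class of tensors `V_χ(G)`, the image of the symmetrizer. -/
noncomputable def symmetryClass (T : G →* Equiv.Perm ι) (χ : G → ℂ) (V : Type*)
    [NormedAddCommGroup V] [InnerProductSpace ℂ V] : Submodule ℂ (⨂[ℂ] _ : ι, V) :=
  LinearMap.range (symmetrizer T χ V)

/-- The decomposable symmetrized tensor `e*_α = T(G, χ)(e_{α(1)} ⊗ ⋯ ⊗ e_{α(m)})`. -/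
noncomputable def starTensor (T : G →* Equiv.Perm ι) (χ : G → ℂ) {d : ℕ} (e : Fin d → V)
    (α : ι → Fin d) : ⨂[ℂ] _ : ι, V :=
  symmetrizer T χ V (PiTensorProduct.tprod ℂ fun i => e (α i))

/-- `V_χ(G)` has an orthogonal *-basis with respect to the orthonormal basis `e` of `V`: some set of
decomposable symmetrized tensors `e*_α` is a basis of `V_χ(G)` with pairwise orthogonal members. -/
def HasOrthogonalStarBasis (T : G →* Equiv.Perm ι) (χ : G → ℂ) {d : ℕ}
    (e : OrthonormalBasis (Fin d) ℂ V) : Prop :=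
  ∃ B : Set (⨂[ℂ] _ : ι, V),
    B ⊆ Set.range (starTensor T χ e) ∧
    LinearIndepOn ℂ id B ∧
    Submodule.span ℂ B = symmetryClass T χ V ∧
    B.Pairwise fun x y => tensorInner x y = 0

end

end SymmetryClass

/-!
Only the rotations contribute to `ς`, since `ς` vanishes on the elements `b a^r`. The indices `α`
with one entry `q` and all others `p ≠ q` form a single orbit, and Schur orthogonality makes
`T(G, ς)` an orthogonal projection, so the Gram matrix of the `e*_α` in this orbit is, up to a
nonzero factor, the circulant matrix `ς(a^{j-i})`. No entry of it vanishes when `n` is odd: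
`ς(a^r) = ω^{hr} + ω^{-hr} = 0` would give `ω^{2hr} = -1`, but `ω^{2hr}` is an `n`-th root of unity
since `h` is even. Hence an orthogonal `*`-basis contains at most one of these `e*_α`, and as they
are orthogonal to all others, the Gram matrix has rank at most one. But its minor on the rows and
columns `0`, `1` is `ς(1)² - ς(a)² = 4 sin² (hπ/2n) ≠ 0`.
-/

theorem mul_eq_mul_of_mem_span {R M : Type*} [CommSemiring R] [AddCommMonoid M] [Module R M]
    {B : Set M} {φ ψ : M →ₗ[R] R} (hB : {x ∈ B | φ x ≠ 0 ∨ ψ x ≠ 0}.Subsingleton) {x y : M}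
    (hx : x ∈ Submodule.span R B) (hy : y ∈ Submodule.span R B) :
    φ x * ψ y = φ y * ψ x := by
  induction hx, hy using Submodule.span_induction₂ with
  | mem_mem x y hx hy =>
    by_cases hx' : φ x ≠ 0 ∨ ψ x ≠ 0
    · by_cases hy' : φ y ≠ 0 ∨ ψ y ≠ 0
      · rw [hB ⟨hx, hx'⟩ ⟨hy, hy'⟩]
      · obtain ⟨hφ, hψ⟩ : φ y = 0 ∧ ψ y = 0 := by simpa using hy'
        rw [hφ, hψ, mul_zero, zero_mul]
    · obtain ⟨hφ, hψ⟩ : φ x = 0 ∧ ψ x = 0 := by simpa using hx'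
      rw [hφ, hψ, mul_zero, zero_mul]
  | zero_left => simp
  | zero_right => simp
  | add_left x y z _ _ _ hxz hyz => rw [map_add, map_add, add_mul, mul_add, hxz, hyz]
  | add_right x y z _ _ _ hxy hxz => rw [map_add, map_add, add_mul, mul_add, hxy, hxz]
  | smul_left r x y _ _ hxy => simp only [map_smul, smul_eq_mul, mul_assoc, hxy, mul_left_comm]
  | smul_right r x y _ _ hxy => simp only [map_smul, smul_eq_mul, mul_assoc, hxy, mul_left_comm]

theorem addChar_mul_neg {A M : Type*} [AddGroup A] [Monoid M] (ψ : AddChar A M) (x : A) :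
    ψ x * ψ (-x) = 1 := by
  rw [← AddChar.map_add_eq_mul, add_neg_cancel, AddChar.map_zero_eq_one]

namespace SymmetryClass

open PiTensorProduct ComplexConjugate

section TensorInner

variable {ι : Type*} [Fintype ι] {V : Type*} [NormedAddCommGroup V] [InnerProductSpace ℂ V]

/-- The inner product `tensorInner` as a bundled sesquilinear form, which makes its additivity and
homogeneity available in both arguments. -/
noncomputable def tensorForm : (⨂[ℂ] _ : ι, V) →ₗ⋆[ℂ] (⨂[ℂ] _ : ι, V) →ₗ[ℂ] ℂ :=
  (PiTensorProduct.lift innerTprodConj).flip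

theorem tensorForm_apply (x y : ⨂[ℂ] _ : ι, V) : tensorForm x y = tensorInner x y := rfl

theorem tensorInner_tprod_orthonormalBasis {κ : Type*} [Fintype κ] [DecidableEq κ]
    (e : OrthonormalBasis κ ℂ V) (α β : ι → κ) :
    tensorInner (tprod ℂ fun i => e (α i)) (tprod ℂ fun i => e (β i)) =
      if α = β then 1 else 0 := by
  simp only [tensorInner_tprod, e.inner_eq_ite, Finset.prod_ite_zero, Finset.prod_const_one,
    Finset.mem_univ, true_imp_iff, funext_iff]

theorem tensorInner_reindex_left (σ : Equiv.Perm ι) (x y : ⨂[ℂ] _ : ι, V) :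
    tensorInner (reindex ℂ (fun _ => V) σ x) y =
      tensorInner x (reindex ℂ (fun _ => V) σ⁻¹ y) := by
  simp only [← tensorForm_apply]
  induction x using PiTensorProduct.induction_on with
  | add x x' hx hx' => simp only [map_add, LinearMap.add_apply, hx, hx']
  | smul_tprod r v =>
    simp only [map_smulₛₗ, RingHom.id_apply, LinearMap.smul_apply]
    congr 1
    induction y using PiTensorProduct.induction_on with
    | add y y' hy hy' => simp only [map_add, hy, hy']
    | smul_tprod s u =>
      simp only [map_smul, reindex_tprod, tensorForm_apply, tensorInner_tprod]
      congr 1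
      exact Fintype.prod_equiv σ.symm _ _ fun i => by simp [Equiv.Perm.inv_def]

end TensorInner

/-- The representation `g ↦ P_{T g}` of `G` on the tensor power of `V`. -/
noncomputable def tensorPerm {ι G : Type*} [Group G] (T : G →* Equiv.Perm ι) (V : Type*)
    [AddCommMonoid V] [Module ℂ V] : Representation ℂ G (⨂[ℂ] _ : ι, V) where
  toFun g := (reindex ℂ (fun _ => V) (T g)).toLinearMap
  map_one' := by
    ext v
    simp only [LinearMap.compMultilinearMap_apply, LinearEquiv.coe_coe, map_one, reindex_tprod]
    rfl
  map_mul' g h := by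
    ext v
    simp only [LinearMap.compMultilinearMap_apply, LinearEquiv.coe_coe, map_mul,
      Module.End.mul_apply, reindex_tprod]
    rfl

section PointIndex

variable {ι κ : Type*} [DecidableEq ι] {p q : κ}

/-- The multi-index with entry `q` at the point `j` and `p` elsewhere. For `p ≠ q` these indices
turn the action of `G` on `ι` into one on multi-indices. -/
def pointIndex (p q : κ) (j : ι) : ι → κ :=
  Function.update (Function.const ι p) j q

theorem pointIndex_injective (hpq : p ≠ q) :
    Function.Injective (pointIndex p q : ι → ι → κ) := by
  intro i j hij
  by_contra hne
  refine hpq ?_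
  simpa [pointIndex, hne] using (congrFun hij i).symm

theorem pointIndex_comp_perm (p q : κ) (j : ι) (σ : Equiv.Perm ι) :
    pointIndex p q j ∘ σ = pointIndex p q (σ.symm j) :=
  Function.update_comp_equiv _ σ j q

end PointIndex

section Symmetrizer

variable {G : Type*} [Group G] [Fintype G]

/-- The relations satisfied by an irreducible character `χ`: it is Hermitian, and Schur
orthogonality makes `χ(1)/|G| ∑ χ(g) g` an idempotent of the group algebra. -/
structure IsHermitianIdempotent (χ : G → ℂ) : Prop where
  conj_apply : ∀ g, conj (χ g) = χ g⁻¹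
  sum_mul_inv_mul : ∀ k, χ 1 / Fintype.card G * ∑ g, χ g * χ (g⁻¹ * k) = χ k

namespace IsHermitianIdempotent

variable {χ : G → ℂ}

theorem apply_one_ne_zero (hχ : IsHermitianIdempotent χ) (hne : χ ≠ 0) : χ 1 ≠ 0 := fun h1 =>
  hne <| funext fun k => by rw [← hχ.sum_mul_inv_mul k, h1, zero_div, zero_mul, Pi.zero_apply]

theorem isIdempotentElem_smul_sum (hχ : IsHermitianIdempotent χ) {A : Type*} [Semiring A]
    [Algebra ℂ A] (ρ : G →* A) :
    IsIdempotentElem ((χ 1 / Fintype.card G) • ∑ g, χ g • ρ g) := by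
  have hsum : (∑ g, χ g • ρ g) * ∑ g, χ g • ρ g = ∑ k, (∑ g, χ g * χ (g⁻¹ * k)) • ρ k := by
    simp only [Finset.sum_mul_sum, Finset.sum_smul]
    rw [Finset.sum_comm (γ := G) (f := fun k g => (χ g * χ (g⁻¹ * k)) • ρ k)]
    refine Finset.sum_congr rfl fun g _ => ?_
    rw [← Equiv.sum_comp (Equiv.mulLeft g) fun k => (χ g * χ (g⁻¹ * k)) • ρ k]
    simp [smul_smul, mul_comm]
  rw [IsIdempotentElem, smul_mul_smul_comm, hsum, mul_smul, Finset.smul_sum]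
  simp only [smul_smul, hχ.sum_mul_inv_mul]

end IsHermitianIdempotent

variable {ι : Type*} {V : Type*} [NormedAddCommGroup V] [InnerProductSpace ℂ V]
  {T : G →* Equiv.Perm ι} {χ : G → ℂ} {d : ℕ}

theorem starTensor_eq (e : Fin d → V) (α : ι → Fin d) :
    starTensor T χ e α =
      (χ 1 / Fintype.card G) • ∑ g, χ g • tprod ℂ fun i => e (α ((T g).symm i)) := by
  simp [starTensor, symmetrizer]

variable [Fintype ι]

theorem tensorInner_symmetrizer_left (hχ : IsHermitianIdempotent χ) (x y : ⨂[ℂ] _ : ι, V) :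
    tensorInner (symmetrizer T χ V x) y = tensorInner x (symmetrizer T χ V y) := by
  simp only [← tensorForm_apply, symmetrizer, LinearMap.smul_apply, LinearMap.sum_apply, map_smul,
    map_smulₛₗ, map_sum, hχ.conj_apply, map_div₀, inv_one, map_natCast, smul_eq_mul]
  congr 1
  rw [← Equiv.sum_comp (Equiv.inv G)]
  refine Finset.sum_congr rfl fun g _ => ?_
  simp [tensorForm_apply, tensorInner_reindex_left]

theorem tensorInner_starTensor (hχ : IsHermitianIdempotent χ) (e : OrthonormalBasis (Fin d) ℂ V)
    (α β : ι → Fin d) :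
    tensorInner (starTensor T χ e α) (starTensor T χ e β) =
      χ 1 / Fintype.card G * ∑ g with α ∘ T g = β, χ g := by
  have hidem : symmetrizer T χ V (starTensor T χ e β) = starTensor T χ e β :=
    LinearMap.congr_fun (hχ.isIdempotentElem_smul_sum (tensorPerm T V)) _
  have hcomp (g : G) : (α = fun i => β ((T g).symm i)) ↔ α ∘ T g = β :=
    Equiv.eq_comp_symm (T g) α β
  rw [starTensor, tensorInner_symmetrizer_left hχ, hidem, starTensor_eq, ← tensorForm_apply]
  simp only [map_smul, map_sum, smul_eq_mul, tensorForm_apply]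
  simp [tensorInner_tprod_orthonormalBasis, Finset.sum_filter, hcomp]

theorem HasOrthogonalStarBasis.tensorInner_mul_tensorInner {e : OrthonormalBasis (Fin d) ℂ V}
    (hbasis : HasOrthogonalStarBasis T χ e) {S : Set (ι → Fin d)}
    (hne : ∀ α ∈ S, ∀ β ∈ S, tensorInner (starTensor T χ e α) (starTensor T χ e β) ≠ 0)
    (horth : ∀ α ∈ S, ∀ β ∉ S, tensorInner (starTensor T χ e α) (starTensor T χ e β) = 0)
    {α β : ι → Fin d} (hα : α ∈ S) (hβ : β ∈ S) :
    tensorInner (starTensor T χ e α) (starTensor T χ e α) *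
        tensorInner (starTensor T χ e β) (starTensor T χ e β) =
      tensorInner (starTensor T χ e α) (starTensor T χ e β) *
        tensorInner (starTensor T χ e β) (starTensor T χ e α) := by
  obtain ⟨B, hB, -, hspan, hBorth⟩ := hbasis
  have mem_span (γ) : starTensor T χ e γ ∈ Submodule.span ℂ B :=
    hspan ▸ LinearMap.mem_range_self _ _
  have mem_S {γ} (h : tensorInner (starTensor T χ e α) (starTensor T χ e γ) ≠ 0 ∨
      tensorInner (starTensor T χ e β) (starTensor T χ e γ) ≠ 0) : γ ∈ S := by
    by_contra hγ
    exact h.elim (· (horth α hα γ hγ)) (· (horth β hβ γ hγ))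
  refine mul_eq_mul_of_mem_span (φ := tensorForm (starTensor T χ e α))
    (ψ := tensorForm (starTensor T χ e β)) ?_ (mem_span α) (mem_span β)
  rintro _ ⟨hx, hx'⟩ _ ⟨hy, hy'⟩
  obtain ⟨γ, rfl⟩ := hB hx
  obtain ⟨δ, rfl⟩ := hB hy
  by_contra hγδ
  exact hne γ (mem_S hx') δ (mem_S hy') (hBorth hx hy hγδ)

variable [DecidableEq ι]

theorem tensorInner_starTensor_pointIndex (hχ : IsHermitianIdempotent χ)
    (e : OrthonormalBasis (Fin d) ℂ V) {p q : Fin d} (hpq : p ≠ q) (i j : ι) :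
    tensorInner (starTensor T χ e (pointIndex p q i)) (starTensor T χ e (pointIndex p q j)) =
      χ 1 / Fintype.card G * ∑ g with T g j = i, χ g := by
  have hcomp (g : G) : pointIndex p q i ∘ T g = pointIndex p q j ↔ T g j = i := by
    rw [pointIndex_comp_perm, (pointIndex_injective hpq).eq_iff, Equiv.symm_apply_eq, eq_comm]
  simp only [tensorInner_starTensor hχ, hcomp]

theorem tensorInner_starTensor_eq_zero_of_notMem_range (hχ : IsHermitianIdempotent χ)
    (e : OrthonormalBasis (Fin d) ℂ V) (p q : Fin d) (j : ι) {β : ι → Fin d}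
    (hβ : β ∉ Set.range (pointIndex p q)) :
    tensorInner (starTensor T χ e (pointIndex p q j)) (starTensor T χ e β) = 0 := by
  rw [tensorInner_starTensor hχ, Finset.sum_filter, Finset.sum_eq_zero, mul_zero]
  refine fun g _ => if_neg ?_
  rintro rfl
  exact hβ ⟨(T g).symm j, (pointIndex_comp_perm p q j (T g)).symm⟩

theorem HasOrthogonalStarBasis.sum_mul_sum {e : OrthonormalBasis (Fin d) ℂ V}
    (hbasis : HasOrthogonalStarBasis T χ e) (hχ : IsHermitianIdempotent χ) (hd : 2 ≤ d)
    (hne : ∀ i j, ∑ g with T g i = j, χ g ≠ 0) (i j : ι) :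
    (∑ g with T g i = i, χ g) * ∑ g with T g j = j, χ g =
      (∑ g with T g i = j, χ g) * ∑ g with T g j = i, χ g := by
  obtain ⟨p, q, hpq⟩ : ∃ p q : Fin d, p ≠ q := ⟨⟨0, by omega⟩, ⟨1, by omega⟩, by simp⟩
  have hχ0 : χ ≠ 0 := by
    rintro rfl
    exact hne i i (by simp)
  have hc : χ 1 / Fintype.card G ≠ 0 :=
    div_ne_zero (hχ.apply_one_ne_zero hχ0) (Nat.cast_ne_zero.2 Fintype.card_ne_zero)
  have hgram := hbasis.tensorInner_mul_tensorInner (S := Set.range (pointIndex p q))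
    (Set.forall_mem_range.2 fun i => Set.forall_mem_range.2 fun j => by
      rw [tensorInner_starTensor_pointIndex hχ e hpq]
      exact mul_ne_zero hc (hne j i))
    (Set.forall_mem_range.2 fun i _ => tensorInner_starTensor_eq_zero_of_notMem_range hχ e p q i)
    ⟨i, rfl⟩ ⟨j, rfl⟩
  simp only [tensorInner_starTensor_pointIndex hχ e hpq] at hgram
  refine mul_left_cancel₀ (mul_ne_zero hc hc) ?_
  linear_combination hgram

end Symmetrizer

end SymmetryClass

namespace SemidihedralGroup

open SymmetryClass ZMod

variable {n m : ℕ}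

theorem exists_eq_two_mul_of_mem_CdagEven {h : ℕ} (hh : h ∈ CdagEven n) :
    ∃ m, h = 2 * m ∧ ¬ n ∣ m := by
  obtain ⟨⟨heven, hle⟩, hne⟩ := hh
  obtain ⟨m, rfl⟩ := even_iff_two_dvd.1 heven
  refine ⟨m, rfl, fun hdvd => hne ?_⟩
  rcases Nat.eq_zero_or_pos m with rfl | hpos
  · exact Or.inl rfl
  · have := Nat.le_of_dvd hpos hdvd
    exact Or.inr (show 2 * m = 2 * n by omega)

theorem four_mul_cast_ne_zero (hm : ¬ n ∣ m) : (4 * m : ZMod (4 * n)) ≠ 0 := by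
  suffices ((4 * m : ℕ) : ZMod (4 * n)) ≠ 0 by simpa using this
  rwa [Ne, natCast_eq_zero_iff, Nat.mul_dvd_mul_iff_left four_pos]

variable [NeZero n]

theorem omega_pow_eq_stdAddChar (k : ℕ) : omega n ^ k = stdAddChar (k : ZMod (4 * n)) := by
  have hn : (n : ℂ) ≠ 0 := Nat.cast_ne_zero.2 (NeZero.ne n)
  rw [← Int.cast_natCast k, stdAddChar_coe, omega, ← Complex.exp_nat_mul]
  congr 1
  push_cast
  field_simp
  ring

theorem sigmaChar_a_eq_stdAddChar (m : ℕ) (r : ZMod (4 * n)) :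
    sigmaChar n (2 * m) (a r) =
      stdAddChar (2 * m * r : ZMod (4 * n)) + stdAddChar (-(2 * m * r) : ZMod (4 * n)) := by
  change Matrix.trace !![omega n ^ (2 * m * r.val), 0;
    0, omega n ^ ((2 * n - 1) * (2 * m) * r.val)] = _
  rw [Matrix.trace_fin_two_of, omega_pow_eq_stdAddChar, omega_pow_eq_stdAddChar]
  push_cast [cast_two_mul_sub_one, natCast_zmod_val]
  congr 2
  linear_combination (m * r : ZMod (4 * n)) * four_mul_cast_eq_zero n

theorem sigmaChar_a_neg (m : ℕ) (r : ZMod (4 * n)) :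
    sigmaChar n (2 * m) (a (-r)) = sigmaChar n (2 * m) (a r) := by
  simp only [sigmaChar_a_eq_stdAddChar, mul_neg, neg_neg, add_comm]

theorem sigmaChar_one (m : ℕ) : sigmaChar n (2 * m) 1 = 2 := by
  rw [one_def, sigmaChar_a_eq_stdAddChar]
  norm_num

theorem sigmaChar_a_ne_zero (hodd : Odd (n / n.gcd m)) (r : ZMod (4 * n)) :
    sigmaChar n (2 * m) (a r) ≠ 0 := by
  rw [sigmaChar_a_eq_stdAddChar]
  intro h0
  have hneg : stdAddChar (4 * m * r : ZMod (4 * n)) = -1 := by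
    rw [show (4 * m * r : ZMod (4 * n)) = 2 * m * r + 2 * m * r by ring, AddChar.map_add_eq_mul]
    linear_combination
      stdAddChar (2 * m * r : ZMod (4 * n)) * h0 - addChar_mul_neg stdAddChar (2 * m * r)
  have hzero : (n / n.gcd m) • (4 * m * r : ZMod (4 * n)) = 0 := by
    have hgcd : n / n.gcd m * m = n * (m / n.gcd m) := by
      rw [Nat.div_mul_right_comm (n.gcd_dvd_left m), Nat.mul_div_assoc n (n.gcd_dvd_right m)]
    have hcast := congrArg (Nat.cast : ℕ → ZMod (4 * n)) hgcd
    push_cast at hcast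
    rw [nsmul_eq_mul]
    linear_combination 4 * r * hcast + (m / n.gcd m : ℕ) * r * four_mul_cast_eq_zero n
  have hone := AddChar.map_nsmul_eq_pow stdAddChar (n / n.gcd m) (4 * m * r : ZMod (4 * n))
  rw [hzero, hneg, hodd.neg_one_pow, AddChar.map_zero_eq_one] at hone
  norm_num at hone

theorem sigmaChar_a_one_sq_ne_four (hm : ¬ n ∣ m) : sigmaChar n (2 * m) (a 1) ^ 2 ≠ 4 := by
  rw [sigmaChar_a_eq_stdAddChar, mul_one]
  intro h4
  have hsq :
      (stdAddChar (2 * m : ZMod (4 * n)) - stdAddChar (-(2 * m) : ZMod (4 * n))) ^ 2 = 0 := by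
    linear_combination h4 - 4 * addChar_mul_neg stdAddChar (2 * m : ZMod (4 * n))
  have heq : (2 * m : ZMod (4 * n)) = -(2 * m) :=
    injective_stdAddChar (sub_eq_zero.1 (pow_eq_zero_iff two_ne_zero |>.1 hsq))
  exact four_mul_cast_ne_zero hm (by linear_combination heq)

theorem sum_sigmaChar_a_mul_sigmaChar_a_sub (hm : ¬ n ∣ m) (s : ZMod (4 * n)) :
    ∑ r, sigmaChar n (2 * m) (a r) * sigmaChar n (2 * m) (a (s - r)) =
      4 * n * sigmaChar n (2 * m) (a s) := by
  have hsum {b : ZMod (4 * n)} (hb : b ≠ 0) : ∑ r, stdAddChar (r * b) = (0 : ℂ) := by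
    rw [AddChar.sum_mulShift b (isPrimitive_stdAddChar _), if_neg hb, Nat.cast_zero]
  have hmul (r : ZMod (4 * n)) :
      sigmaChar n (2 * m) (a r) * sigmaChar n (2 * m) (a (s - r)) =
        stdAddChar (-(2 * m * s) : ZMod (4 * n)) * stdAddChar (r * (4 * m) : ZMod (4 * n)) +
          stdAddChar (2 * m * s : ZMod (4 * n)) * stdAddChar (r * -(4 * m) : ZMod (4 * n)) +
          sigmaChar n (2 * m) (a s) := by
    simp only [sigmaChar_a_eq_stdAddChar, add_mul, mul_add, ← AddChar.map_add_eq_mul]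
    ring_nf
  simp only [hmul, Finset.sum_add_distrib, ← Finset.mul_sum, hsum (four_mul_cast_ne_zero hm),
    hsum (neg_ne_zero.2 (four_mul_cast_ne_zero hm)), Finset.sum_const, Finset.card_univ, card]
  simp

theorem sum_eq_sum_a {M : Type*} [AddCommMonoid M] {f : SemidihedralGroup n → M}
    (hf : ∀ r, f (ba r) = 0) : ∑ g, f g = ∑ r, f (a r) := by
  rw [← Equiv.sum_comp (equivSum n).symm, Fintype.sum_sum_type]
  simp only [equivSum, Equiv.coe_fn_symm_mk, hf, Finset.sum_const_zero, add_zero]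

theorem isHermitianIdempotent_sigmaChar (hm : ¬ n ∣ m) :
    IsHermitianIdempotent (sigmaChar n (2 * m)) where
  conj_apply := by
    rintro (r | r)
    · change _ = sigmaChar n (2 * m) (a (-r))
      simp only [sigmaChar_a_eq_stdAddChar, map_add, ← AddChar.map_neg_eq_conj, mul_neg]
    · change _ = sigmaChar n (2 * m) (ba _)
      simp only [sigmaChar_ba, map_zero]
  sum_mul_inv_mul k := by
    have hn : (n : ℂ) ≠ 0 := Nat.cast_ne_zero.2 (NeZero.ne n)
    have ha_inv (r : ZMod (4 * n)) : (a r)⁻¹ = a (-r) := rfl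
    rw [sum_eq_sum_a fun r => by rw [sigmaChar_ba, zero_mul], sigmaChar_one, card_eq]
    rcases k with (s | s)
    · simp only [ha_inv, a_mul_a, neg_add_eq_sub, sum_sigmaChar_a_mul_sigmaChar_a_sub hm]
      push_cast
      field_simp
      norm_num
    · simp only [ha_inv, a_mul_ba, sigmaChar_ba, mul_zero, Finset.sum_const_zero]

theorem sum_sigmaChar_filter_toPerm (h : ℕ) (i j : ZMod (4 * n)) :
    ∑ g with toPerm n g i = j, sigmaChar n h g = sigmaChar n h (a (j - i)) := by
  have htoPerm (r : ZMod (4 * n)) : toPerm n (a r) i = j ↔ r = j - i :=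
    (eq_sub_iff_add_eq' (a := r) (b := j) (c := i)).symm
  rw [Finset.sum_filter, sum_eq_sum_a fun r => by rw [sigmaChar_ba, ite_self]]
  simp only [htoPerm, Finset.sum_ite_eq', Finset.mem_univ, if_true]

end SemidihedralGroup

open SymmetryClass SemidihedralGroup

theorem corollary3p5_general {n m : ℕ} [NeZero n] (hm : ¬ n ∣ m) (hodd : Odd (n / n.gcd m))
    {V : Type*} [NormedAddCommGroup V] [InnerProductSpace ℂ V] {d : ℕ} (hd : 2 ≤ d)
    (e : OrthonormalBasis (Fin d) ℂ V) :
    ¬ HasOrthogonalStarBasis (toPerm n) (sigmaChar n (2 * m)) e := by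
  intro hbasis
  have hdet := hbasis.sum_mul_sum (isHermitianIdempotent_sigmaChar hm) hd
    (fun i j => sum_sigmaChar_filter_toPerm (2 * m) i j ▸ sigmaChar_a_ne_zero hodd _) 0 1
  simp only [sum_sigmaChar_filter_toPerm, sub_self, sub_zero, zero_sub, ← one_def,
    sigmaChar_one, sigmaChar_a_neg] at hdet
  exact sigmaChar_a_one_sq_ne_four hm (by linear_combination -hdet)

theorem corollary3p5 {n : ℕ} [NeZero n] (hn : 2 ≤ n) (hodd : Odd n)
    {h : ℕ} (hh : h ∈ SemidihedralGroup.CdagEven n)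
    {V : Type*} [NormedAddCommGroup V] [InnerProductSpace ℂ V] [FiniteDimensional ℂ V]
    (hV : 2 ≤ Module.finrank ℂ V)
    {d : ℕ} (e : OrthonormalBasis (Fin d) ℂ V) :
    ¬ SymmetryClass.HasOrthogonalStarBasis (SemidihedralGroup.toPerm n)
        (SemidihedralGroup.sigmaChar n h) e := by
  obtain ⟨m, rfl, hm⟩ := exists_eq_two_mul_of_mem_CdagEven hh
  exact corollary3p5_general hm (hodd.of_dvd_nat (Nat.div_dvd_of_dvd (n.gcd_dvd_left m)))
    (by rwa [Module.finrank_eq_card_basis e.toBasis, Fintype.card_fin] at hV) e
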